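/- Let $n\in\mathbb N$ and consider $n$ bosonic modes on Fock space, with annihilation and creation operators $a_j,a_j^\dagger$, $[a_j,a_k^\dagger]=\delta_{jk}$, and quadratures $\hat r=(\hat x_1,\hat p_1,\dots,\hat x_n,\hat p_n)$, $\hat x_j=\frac1{\sqrt2}(a_j+a_j^\dagger)$, $\hat p_j=-\frac{i}{\sqrt2}(a_j-a_j^\dagger)$. For $c\in\mathbb C^n$ put $a(c)=\sum_j\overline{c_j}\,a_j$, $a^\dagger(c)=\sum_j c_j a_j^\dagger$, and $$m_c=\tfrac1{\sqrt2}(c_1,-ic_1,\dots,c_n,-ic_n)^T\in\mathbb C^{2n}.$$ A state $\rho$ (a positive operator with trace one) has displacement vector $d\in\mathbb R^{2n}$, $d_i=\mathrm{Tr}(\hat r_i\rho)$, and covariance matrix $V_{ij}=\mathrm{Tr}(\{\hat r_i,\hat r_j\}\rho)-2d_id_j$; it is Gaussian with displacement vector $d$ and covariance matrix $V$ if moreover its characteristic function $\chi(z)=\mathrm{Tr}\big(\rho\, e^{a^\dagger(z)-a(z)}\big)$ is $$\chi(z)=\exp\!\Big(-\tfrac12\,\xi^T\Omega V\Omega^T\xi-i\sqrt2\,(\Omega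 d)^T\xi\Big),\qquad z_j=\xi_{j1}+i\xi_{j2},\quad \xi=(\xi_{11},\xi_{12},\dots,\xi_{n1},\xi_{n2})\in\mathbb R^{2n},\quad \Omega=\bigoplus_{j=1}^n\begin{pmatrix}0&1\\-1&0\end{pmatrix}.$$ Let $\rho^G$ be a Gaussian state with covariance matrix $V$ and displacement vector $d$, and let $c\in\mathbb C^n$. Then $a(c)\,\rho^G a^\dagger(c)=0$ if and only if $m_c\in\mathrm{Ker}(V-\mathbb I)$ and $\overline{m_c}\cdot d=0$, where $u\cdot v=\sum_i u_iv_i$. -/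

import Mathlib

open scoped ComplexConjugate ENNReal Matrix Kronecker

noncomputable section

namespace PhotonSub

/-! ### The `n`-mode Fock space and its ladder operators -/

/-- Number configurations `k = (k₁, …, kₙ)` of `n` modes. -/
abbrev Conf (n : ℕ) : Type := Fin n → ℕ

/-- All (not necessarily square-summable) families of coefficients in the number basis.  The ladder
operators act on all of them; an unbounded operator on Fock space has as its domain the vectors
that are mapped into Fock space. -/
abbrev Coeffs (n : ℕ) : Type := Conf n → ℂ

/-- The state space of `n` modes: square-summable coefficients in the number basis. -/
abbrev Fock (n : ℕ) : Type := lp (fun _ : Conf n => ℂ) 2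

/-- A vector of Fock space as a family of coefficients. -/
def coeff {n : ℕ} : Fock n →ₗ[ℂ] Coeffs n where
  toFun ψ := fun k => ψ k
  map_add' _ _ := rfl
  map_smul' _ _ := rfl

/-- The number state `|k⟩`. -/
def numState {n : ℕ} (k : Conf n) : Fock n := lp.single 2 k (1 : ℂ)

/-- The annihilation operator `a_j`, i.e. `a_j |k⟩ = √k_j |k - e_j⟩`. -/
def ann {n : ℕ} (j : Fin n) : Coeffs n →ₗ[ℂ] Coeffs n where
  toFun ψ := fun k => (Real.sqrt ((k j : ℝ) + 1) : ℂ) * ψ (k + Pi.single j 1)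
  map_add' ψ χ := by funext k; simp [mul_add]
  map_smul' s ψ := by funext k; simp [mul_left_comm]

/-- The creation operator `a_j†`, i.e. `a_j† |k⟩ = √(k_j + 1) |k + e_j⟩`.  (If `k_j = 0`, the factor
`√k_j` removes the term with the truncated subtraction.) -/
def cre {n : ℕ} (j : Fin n) : Coeffs n →ₗ[ℂ] Coeffs n where
  toFun ψ := fun k => (Real.sqrt (k j : ℝ) : ℂ) * ψ (k - Pi.single j 1)
  map_add' ψ χ := by funext k; simp [mul_add]
  map_smul' s ψ := by funext k; simp [mul_left_comm]

/-- `a(c) = ∑ⱼ c̄ⱼ aⱼ`. -/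
def annC {n : ℕ} (c : Fin n → ℂ) : Coeffs n →ₗ[ℂ] Coeffs n := ∑ j, conj (c j) • ann j

/-- `a†(c) = ∑ⱼ cⱼ aⱼ†`. -/
def creC {n : ℕ} (c : Fin n → ℂ) : Coeffs n →ₗ[ℂ] Coeffs n := ∑ j, c j • cre j

/-- The quadratures `(x̂₁, p̂₁, …, x̂ₙ, p̂ₙ)`, the index `(j, 0)` standing for
`x̂ⱼ = (aⱼ + aⱼ†) / √2` and `(j, 1)` for `p̂ⱼ = -i (aⱼ - aⱼ†) / √2`. -/
def quad {n : ℕ} (i : Fin n × Fin 2) : Coeffs n →ₗ[ℂ] Coeffs n :=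
  if i.2 = 0 then (1 / (Real.sqrt 2 : ℂ)) • (ann i.1 + cre i.1)
  else (-Complex.I / (Real.sqrt 2 : ℂ)) • (ann i.1 - cre i.1)

/-! ### States and their first and second moments -/

/-- A quantum state: a positive (bounded) operator with trace one. -/
structure IsState {n : ℕ} (ρ : Fock n →L[ℂ] Fock n) : Prop where
  pos : ρ.IsPositive
  trace_one : HasSum (fun k : Conf n => coeff (ρ (numState k)) k) 1

/-- `Tr (T ρ) = t`, i.e. `∑ₖ ⟨k| T ρ |k⟩` converges with sum `t`. -/
def HasMean {n : ℕ} (ρ : Fock n →L[ℂ] Fock n) (T : Coeffs n →ₗ[ℂ] Coeffs n) (t : ℂ) : Prop :=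
  HasSum (fun k : Conf n => T (coeff (ρ (numState k))) k) t

/-- `d` is the displacement vector of `ρ`: `dᵢ = ⟨r̂ᵢ⟩ = Tr (r̂ᵢ ρ)`. -/
def HasDisplacement {n : ℕ} (ρ : Fock n →L[ℂ] Fock n) (d : Fin n × Fin 2 → ℝ) : Prop :=
  ∀ i, HasMean ρ (quad i) (d i)

/-- `V` is the covariance matrix of the state `ρ` with displacement vector `d`:
`Vᵢⱼ = ⟨{r̂ᵢ, r̂ⱼ}⟩ - 2 ⟨r̂ᵢ⟩ ⟨r̂ⱼ⟩`. -/
def HasCovariance {n : ℕ} (ρ : Fock n →L[ℂ] Fock n) (d : Fin n × Fin 2 → ℝ)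
    (V : Matrix (Fin n × Fin 2) (Fin n × Fin 2) ℝ) : Prop :=
  ∀ i j, ∃ s : ℂ, HasMean ρ (quad i ∘ₗ quad j + quad j ∘ₗ quad i) s ∧
    (V i j : ℂ) = s - 2 * (d i : ℂ) * (d j : ℂ)

/-! ### Displacement operators and characteristic functions -/

/-- Coefficient families with finitely many nonzero entries. -/
def finiteCoeffs (n : ℕ) : Submodule ℂ (Coeffs n) where
  carrier := {ψ | (Function.support ψ).Finite}
  zero_mem' := by simp
  add_mem' {ψ χ} hψ hχ := (hψ.union hχ).subset (Function.support_add ψ χ)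
  smul_mem' s ψ hψ := Set.Finite.subset hψ (Function.support_const_smul_subset s ψ)

theorem ann_mem {n : ℕ} (j : Fin n) {ψ : Coeffs n} (h : ψ ∈ finiteCoeffs n) :
    ann j ψ ∈ finiteCoeffs n := by
  refine Set.Finite.subset (Set.Finite.preimage (f := fun k : Conf n => k + Pi.single j 1)
    (fun _ _ _ _ hab => by simpa using hab) (show (Function.support ψ).Finite from h)) ?_
  intro k hk
  exact right_ne_zero_of_mul hk

theorem cre_mem {n : ℕ} (j : Fin n) {ψ : Coeffs n} (h : ψ ∈ finiteCoeffs n) :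
    cre j ψ ∈ finiteCoeffs n := by
  refine Set.Finite.subset (Set.Finite.image (fun k : Conf n => k + Pi.single j 1)
    (show (Function.support ψ).Finite from h)) ?_
  intro k hk
  refine ⟨k - Pi.single j 1, right_ne_zero_of_mul hk, ?_⟩
  have h0 : k j ≠ 0 := by
    intro h0
    exact hk (by simp [cre, h0])
  funext i
  by_cases hi : i = j
  · subst hi
    simp
    omega
  · simp [Pi.single_eq_of_ne hi]

/-- The generator `a†(z) - a(z)` of the displacement operator `D(z)`. -/
def gen {n : ℕ} (z : Fin n → ℂ) : Coeffs n →ₗ[ℂ] Coeffs n := creC z - annC z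

theorem gen_mem {n : ℕ} (z : Fin n → ℂ) {ψ : Coeffs n} (h : ψ ∈ finiteCoeffs n) :
    gen z ψ ∈ finiteCoeffs n := by
  simp only [gen, creC, annC, LinearMap.sub_apply, LinearMap.sum_apply, LinearMap.smul_apply]
  exact Submodule.sub_mem _
    (Submodule.sum_mem _ fun j _ => Submodule.smul_mem _ _ (cre_mem j h))
    (Submodule.sum_mem _ fun j _ => Submodule.smul_mem _ _ (ann_mem j h))

theorem coeff_numState {n : ℕ} (k l : Conf n) :
    coeff (numState k) l = if l = k then 1 else 0 := by
  change (lp.single 2 k (1 : ℂ) : lp (fun _ : Conf n => ℂ) 2) l = _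
  rw [lp.single_apply, Pi.single_apply]

theorem numState_mem {n : ℕ} (k : Conf n) : coeff (numState k) ∈ finiteCoeffs n := by
  change (Function.support (coeff (numState k))).Finite
  refine Set.Finite.subset (Set.finite_singleton k) ?_
  intro l hl
  by_contra hlk
  exact hl (by rw [coeff_numState, if_neg (by simpa using hlk)])

theorem gen_pow_mem {n : ℕ} (z : Fin n → ℂ) (k : Conf n) (m : ℕ) :
    (gen z ^ m) (coeff (numState k)) ∈ finiteCoeffs n := by
  induction m with
  | zero => simpa using numState_mem k
  | succ m ih =>
    rw [pow_succ']
    exact gen_mem z ih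

theorem memℓp_of_mem {n : ℕ} {ψ : Coeffs n} (h : ψ ∈ finiteCoeffs n) : Memℓp ψ 2 := by
  have h' : (Function.support ψ).Finite := h
  refine memℓp_gen (summable_of_hasFiniteSupport (h'.subset ?_))
  intro k hk hk0
  exact hk (by simp [hk0])

/-- `(a†(z) - a(z))^m |k⟩`, a finite linear combination of number states. -/
def genPow {n : ℕ} (z : Fin n → ℂ) (k : Conf n) (m : ℕ) : Fock n :=
  ⟨(gen z ^ m) (coeff (numState k)), memℓp_of_mem (gen_pow_mem z k m)⟩

theorem ann_numState {n : ℕ} (j : Fin n) (k : Conf n) :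
    ann j (coeff (numState k)) =
      (Real.sqrt (k j : ℝ) : ℂ) • coeff (numState (k - Pi.single j 1)) := by
  funext l
  simp only [ann, LinearMap.coe_mk, AddHom.coe_mk, Pi.smul_apply, smul_eq_mul,
    coeff_numState]
  by_cases h : l + Pi.single j 1 = k
  · subst h
    simp
  · rw [if_neg h]
    by_cases h2 : l = k - Pi.single j 1
    · have h0 : k j = 0 := by
        by_contra h0
        apply h
        subst h2
        funext i
        by_cases hi : i = j
        · subst hi
          simp
          omega
        · simp [Pi.single_eq_of_ne hi]
      simp [h0]
    · rw [if_neg h2]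
      simp

theorem cre_numState {n : ℕ} (j : Fin n) (k : Conf n) :
    cre j (coeff (numState k)) =
      (Real.sqrt ((k j : ℝ) + 1) : ℂ) • coeff (numState (k + Pi.single j 1)) := by
  funext l
  simp only [cre, LinearMap.coe_mk, AddHom.coe_mk, Pi.smul_apply, smul_eq_mul,
    coeff_numState]
  by_cases h : l = k + Pi.single j 1
  · subst h
    simp
  · rw [if_neg h]
    by_cases h2 : l - Pi.single j 1 = k
    · have h0 : l j = 0 := by
        by_contra h0
        apply h
        subst h2
        funext i
        by_cases hi : i = j
        · subst hi
          simp
          omega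
        · simp [Pi.single_eq_of_ne hi]
      simp [h0]
    · rw [if_neg h2]
      simp

theorem genPow_succ {n : ℕ} (z : Fin n → ℂ) (k : Conf n) (m : ℕ) :
    genPow z k (m + 1) =
      ∑ j, (z j * (Real.sqrt ((k j : ℝ) + 1) : ℂ)) • genPow z (k + Pi.single j 1) m -
      ∑ j, (conj (z j) * (Real.sqrt (k j : ℝ) : ℂ)) • genPow z (k - Pi.single j 1) m := by
  have h : (gen z ^ (m + 1)) (coeff (numState k)) =
      ∑ j, (z j * (Real.sqrt ((k j : ℝ) + 1) : ℂ)) •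
        (gen z ^ m) (coeff (numState (k + Pi.single j 1))) -
      ∑ j, (conj (z j) * (Real.sqrt (k j : ℝ) : ℂ)) •
        (gen z ^ m) (coeff (numState (k - Pi.single j 1))) := by
    rw [pow_succ, Module.End.mul_apply]
    conv_lhs => rw [gen]
    simp only [creC, annC, LinearMap.sub_apply, LinearMap.sum_apply, LinearMap.smul_apply,
      ann_numState, cre_numState, map_sub, map_sum, map_smul, smul_smul]
    rfl
  refine Subtype.ext ?_
  rw [AddSubgroupClass.coe_sub, lp.coeFn_sum, lp.coeFn_sum]
  exact h

theorem norm_genPow_le {n : ℕ} (z : Fin n → ℂ) (m : ℕ) : ∀ (k : Conf n) (N : ℕ),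
    (∀ j, k j ≤ N) →
    ‖genPow z k m‖ ≤ ∏ i ∈ Finset.range m, (2 * (1 + ∑ j, ‖z j‖)) * Real.sqrt ((N + i : ℕ) + 1) := by
  induction m with
  | zero =>
    intro k N _
    have h : genPow z k 0 = numState k := rfl
    rw [h, numState, lp.norm_single (by norm_num)]
    simp
  | succ m ih =>
    intro k N hk
    set b : ℝ := ∏ i ∈ Finset.range m, (2 * (1 + ∑ j, ‖z j‖)) * Real.sqrt (((N + 1) + i : ℕ) + 1)
      with hb
    have hb0 : 0 ≤ b := Finset.prod_nonneg fun i _ => by positivity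
    have hup : ∀ j, ‖genPow z (k + Pi.single j 1) m‖ ≤ b := fun j => ih _ (N + 1) fun i => by
      have := hk i
      by_cases hi : i = j
      · subst hi
        simpa using this
      · simp [Pi.single_eq_of_ne hi]
        omega
    have hdn : ∀ j, ‖genPow z (k - Pi.single j 1) m‖ ≤ b := fun j => ih _ (N + 1) fun i => by
      have := hk i
      simp only [Pi.sub_apply]
      omega
    have hs : ∀ j, Real.sqrt ((k j : ℝ) + 1) ≤ Real.sqrt ((N : ℝ) + 1) := fun j =>
      Real.sqrt_le_sqrt (by have := hk j; exact_mod_cast Nat.succ_le_succ this)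
    have hs' : ∀ j, Real.sqrt (k j : ℝ) ≤ Real.sqrt ((N : ℝ) + 1) := fun j =>
      (Real.sqrt_le_sqrt (by linarith)).trans (hs j)
    have h1 : ‖∑ j, (z j * (Real.sqrt ((k j : ℝ) + 1) : ℂ)) • genPow z (k + Pi.single j 1) m‖ ≤
        ∑ j, ‖z j‖ * Real.sqrt ((N : ℝ) + 1) * b := by
      refine norm_sum_le_of_le _ fun j _ => ?_
      rw [norm_smul, norm_mul, Complex.norm_real, Real.norm_of_nonneg (Real.sqrt_nonneg _)]
      gcongr
      · exact hk j
      · exact hup j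
    have h2 : ‖∑ j, (conj (z j) * (Real.sqrt (k j : ℝ) : ℂ)) •
        genPow z (k - Pi.single j 1) m‖ ≤ ∑ j, ‖z j‖ * Real.sqrt ((N : ℝ) + 1) * b := by
      refine norm_sum_le_of_le _ fun j _ => ?_
      rw [norm_smul, norm_mul, Complex.norm_real, Real.norm_of_nonneg (Real.sqrt_nonneg _),
        RCLike.norm_conj]
      gcongr
      · have := hk j
        have h6 : (k j : ℝ) ≤ N := by exact_mod_cast this
        linarith
      · exact hdn j
    have h3 : (∑ j, ‖z j‖ * Real.sqrt ((N : ℝ) + 1) * b) =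
        (∑ j, ‖z j‖) * Real.sqrt ((N : ℝ) + 1) * b := by
      rw [Finset.sum_mul, Finset.sum_mul]
    have h4 : (∏ i ∈ Finset.range (m + 1),
        (2 * (1 + ∑ j, ‖z j‖)) * Real.sqrt ((N + i : ℕ) + 1)) =
        b * ((2 * (1 + ∑ j, ‖z j‖)) * Real.sqrt ((N : ℝ) + 1)) := by
      rw [Finset.prod_range_succ', hb]
      congr 1
      refine Finset.prod_congr rfl fun i _ => ?_
      rw [show N + (i + 1) = N + 1 + i by ring]
    rw [genPow_succ, h4]
    refine (norm_sub_le _ _).trans ?_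
    rw [h3] at h1 h2
    have h5 : 0 ≤ Real.sqrt ((N : ℝ) + 1) * b := by positivity
    nlinarith

/-- The exponential series of the generator converges on number states. -/
theorem summable_displaced {n : ℕ} (z : Fin n → ℂ) (k : Conf n) :
    Summable fun m : ℕ => ((m.factorial : ℂ)⁻¹) • genPow z k m := by
  set C : ℝ := 2 * (1 + ∑ j, ‖z j‖) with hC
  have hC0 : 0 < C := by positivity
  set N : ℕ := ∑ j, k j with hN
  set b : ℕ → ℝ := fun m => (m.factorial : ℝ)⁻¹ *
    ∏ i ∈ Finset.range m, C * Real.sqrt ((N + i : ℕ) + 1) with hb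
  have hpos : ∀ m, 0 < b m := fun m =>
    mul_pos (by positivity) (Finset.prod_pos fun i _ => by positivity)
  have hratio : ∀ m, ‖b (m + 1)‖ / ‖b m‖ =
      C * (Real.sqrt ((N + m : ℕ) + 1) / ((m : ℝ) + 1)) := by
    intro m
    rw [Real.norm_of_nonneg (hpos _).le, Real.norm_of_nonneg (hpos _).le]
    have hp : (∏ i ∈ Finset.range m, C * Real.sqrt ((N + i : ℕ) + 1)) ≠ 0 :=
      (Finset.prod_pos fun i _ => by positivity).ne'
    simp only [hb, Finset.prod_range_succ, Nat.factorial_succ, Nat.cast_mul]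
    have hf : (m.factorial : ℝ) ≠ 0 := by positivity
    push_cast at hp ⊢
    field_simp
  have hlim : Filter.Tendsto (fun m : ℕ => C * (Real.sqrt ((N + m : ℕ) + 1) / ((m : ℝ) + 1)))
      Filter.atTop (nhds 0) := by
    have h1 : Filter.Tendsto (fun m : ℕ => (C * Real.sqrt ((N : ℝ) + 1)) *
        (Real.sqrt ((m : ℝ) + 1))⁻¹) Filter.atTop (nhds 0) := by
      have := (Real.tendsto_sqrt_atTop.comp (Filter.tendsto_atTop_add_const_right _ (1 : ℝ)
        tendsto_natCast_atTop_atTop)).inv_tendsto_atTop.const_mul (C * Real.sqrt ((N : ℝ) + 1))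
      simpa using this
    refine squeeze_zero (fun m => by positivity) (fun m => ?_) h1
    have hm : Real.sqrt ((m : ℝ) + 1) * Real.sqrt ((m : ℝ) + 1) = (m : ℝ) + 1 :=
      Real.mul_self_sqrt (by positivity)
    have hm0 : 0 < Real.sqrt ((m : ℝ) + 1) := by positivity
    have hle : Real.sqrt ((N + m : ℕ) + 1) ≤
        Real.sqrt ((N : ℝ) + 1) * Real.sqrt ((m : ℝ) + 1) := by
      rw [← Real.sqrt_mul (by positivity)]
      refine Real.sqrt_le_sqrt ?_
      push_cast
      nlinarith [mul_nonneg (Nat.cast_nonneg (α := ℝ) N) (Nat.cast_nonneg (α := ℝ) m)]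
    rw [mul_assoc C]
    refine mul_le_mul_of_nonneg_left ?_ hC0.le
    rw [div_le_iff₀ (by positivity), mul_assoc]
    refine hle.trans (le_of_eq ?_)
    generalize Real.sqrt ((m : ℝ) + 1) = q at hm hm0 ⊢
    rw [← hm]
    field_simp
  have hsum : Summable b :=
    summable_of_ratio_test_tendsto_lt_one zero_lt_one
      (Filter.Eventually.of_forall fun m => (hpos m).ne')
      (by simpa only [hratio] using hlim)
  refine Summable.of_norm_bounded hsum fun m => ?_
  rw [norm_smul, norm_inv, Complex.norm_natCast]
  exact mul_le_mul_of_nonneg_left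
    (norm_genPow_le z m k N fun j => Finset.single_le_sum (fun _ _ => Nat.zero_le _)
      (Finset.mem_univ j)) (by positivity)

/-- `D(z) |k⟩`, where `D(z) = exp (a†(z) - a(z))` is the displacement operator; number states are
analytic vectors of the generator, so that the exponential series converges in norm (this is
`summable_displaced`), and these vectors determine the unitary operator `D(z)`. -/
def displaced {n : ℕ} (z : Fin n → ℂ) (k : Conf n) : Fock n :=
  ∑' m : ℕ, ((m.factorial : ℂ)⁻¹) • genPow z k m

/-- The characteristic function `χ(z) = Tr (ρ D(z)) = ∑ₖ ⟨k| ρ D(z) |k⟩`. -/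
def charFn {n : ℕ} (ρ : Fock n →L[ℂ] Fock n) (z : Fin n → ℂ) : ℂ :=
  ∑' k : Conf n, coeff (ρ (displaced z k)) k

/-! ### Gaussian states -/

/-- The symplectic form `Ω = ⨁ⱼ [[0, 1], [-1, 0]]`. -/
def Omega (n : ℕ) : Matrix (Fin n × Fin 2) (Fin n × Fin 2) ℝ :=
  (1 : Matrix (Fin n) (Fin n) ℝ) ⊗ₖ !![0, 1; -1, 0]

/-- `zⱼ = ξⱼ₁ + i ξⱼ₂`. -/
def toComplex {n : ℕ} (ξ : Fin n × Fin 2 → ℝ) : Fin n → ℂ :=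
  fun j => (ξ (j, 0) : ℂ) + Complex.I * (ξ (j, 1) : ℂ)

/-- `ρ` is a Gaussian state with displacement vector `d` and covariance matrix `V`: a state whose
first and second moments are given by `d` and `V` and whose characteristic function is
`χ(ξ) = exp (-½ ξᵀ Ω V Ωᵀ ξ - i √2 (Ω d)ᵀ ξ)`. -/
structure IsGaussianState {n : ℕ} (ρ : Fock n →L[ℂ] Fock n) (d : Fin n × Fin 2 → ℝ)
    (V : Matrix (Fin n × Fin 2) (Fin n × Fin 2) ℝ) : Prop where
  isState : IsState ρ
  displacement : HasDisplacement ρ d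
  covariance : HasCovariance ρ d V
  charFn_eq : ∀ ξ : Fin n × Fin 2 → ℝ, charFn ρ (toComplex ξ) =
    Complex.exp (-(1 / 2) * ((ξ ⬝ᵥ ((Omega n * V * (Omega n)ᵀ) *ᵥ ξ) : ℝ) : ℂ)
      - Complex.I * (Real.sqrt 2 : ℂ) * (((Omega n *ᵥ d) ⬝ᵥ ξ : ℝ) : ℂ))

/-! ### Photon subtraction -/

/-- The domain of the operator `a†(c)`. -/
def creDomain {n : ℕ} (c : Fin n → ℂ) : Submodule ℂ (Fock n) where
  carrier := {ψ | Memℓp (creC c (coeff ψ)) 2}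
  zero_mem' := by
    simp only [Set.mem_ofPred_eq, map_zero]
    exact zero_memℓp
  add_mem' {ψ χ} hψ hχ := by
    simp only [Set.mem_ofPred_eq, map_add] at *
    exact hψ.add hχ
  smul_mem' s ψ hψ := by
    simp only [Set.mem_ofPred_eq, map_smul] at *
    exact hψ.const_smul s

/-- `a†(c)` as an (unbounded) operator on Fock space. -/
def creOp {n : ℕ} (c : Fin n → ℂ) : creDomain c →ₗ[ℂ] Fock n where
  toFun ψ := ⟨creC c (coeff ψ.1), ψ.2⟩
  map_add' ψ χ := Subtype.ext (map_add (creC c ∘ₗ coeff) ψ.1 χ.1)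
  map_smul' s ψ := Subtype.ext (map_smul (creC c ∘ₗ coeff) s ψ.1)

/-- `a(c) ρ a†(c)`, on the domain of `a†(c)`.  (That it is zero includes that `ρ a†(c)` maps into
the domain of `a(c)`, which consists of the vectors whose image under `annC c` is
square-summable.) -/
def subtracted {n : ℕ} (c : Fin n → ℂ) (ρ : Fock n →L[ℂ] Fock n) :
    creDomain c →ₗ[ℂ] Coeffs n :=
  annC c ∘ₗ coeff ∘ₗ (ρ : Fock n →ₗ[ℂ] Fock n) ∘ₗ creOp c

/-- The unitary matrix `U = ⨁ⱼ u` with `u = 2^(-1/2) [[1, i], [1, -i]]`. -/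
def Umat (n : ℕ) : Matrix (Fin n × Fin 2) (Fin n × Fin 2) ℂ :=
  (1 : Matrix (Fin n) (Fin n) ℂ) ⊗ₖ
    ((1 / (Real.sqrt 2 : ℂ)) • !![1, Complex.I; 1, -Complex.I])

/-- `m_c = U† (c₁, 0, …, cₙ, 0)ᵀ`. -/
def mVec {n : ℕ} (c : Fin n → ℂ) : Fin n × Fin 2 → ℂ :=
  (Umat n)ᴴ *ᵥ fun i => if i.2 = 0 then c i.1 else 0

end PhotonSub

end

open scoped ComplexConjugate ENNReal Matrix Kronecker

noncomputable section

namespace PhotonSub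

variable {n : ℕ}

/-! ### Algebra of the ladder operators -/

/-! Positivity gives ρ = S*S, so coefficient k of a(c)ρψ is ⟨S a†(c)k, Sψ⟩ (`annC_coeff`). Taking ψ
= a†(c)|k⟩ shows that the subtracted operator vanishes iff S a†(c)|k⟩ = 0 for all k
(`subtracted_eq_zero_iff`), that is, iff a(c)ρ = 0.

The rest concerns moments, through a(c) = m̄_c · r̂ and a†(c) = m_c · r̂. If a(c)ρ = 0, then ⟨a(c)⟩
= 0 says m̄_c · d = 0, and ⟨{r̂ᵢ, a(c)}⟩ reduces to the commutator [a(c), r̂ᵢ] = (m̄_c)ᵢ, which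
gives V m̄_c = m̄_c (`HasCovariance.mul_conj_mVec`). Conversely, the two conditions give ⟨{a†(c),
a(c)}⟩ = |c|², while the commutation relation gives 2⟨a†(c)a(c)⟩ + |c|². Hence ⟨a†(c)a(c)⟩ = ∑ₖ ‖S
a†(c)|k⟩‖² = 0 and every term vanishes (`HasCovariance.creNum_eq_zero`).

The analytic point is that last series for ⟨a†(c)a(c)⟩ (`hasMean_creC_annC`): it needs reindexing,
justified by finite mean photon numbers. -/

theorem ann_apply (j : Fin n) (ψ : Coeffs n) (k : Conf n) :
    ann j ψ k = (Real.sqrt ((k j : ℝ) + 1) : ℂ) * ψ (k + Pi.single j 1) := rfl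

theorem cre_apply (j : Fin n) (ψ : Coeffs n) (k : Conf n) :
    cre j ψ k = (Real.sqrt (k j : ℝ) : ℂ) * ψ (k - Pi.single j 1) := rfl

theorem annC_apply (c : Fin n → ℂ) (ψ : Coeffs n) (k : Conf n) :
    annC c ψ k =
      ∑ j, conj (c j) * ((Real.sqrt ((k j : ℝ) + 1) : ℂ) * ψ (k + Pi.single j 1)) := by
  simp [annC, LinearMap.sum_apply, Finset.sum_apply, ann_apply]

theorem creC_apply (c : Fin n → ℂ) (ψ : Coeffs n) (k : Conf n) :
    creC c ψ k = ∑ j, c j * ((Real.sqrt (k j : ℝ) : ℂ) * ψ (k - Pi.single j 1)) := by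
  simp [creC, LinearMap.sum_apply, Finset.sum_apply, cre_apply]

theorem sqrt_mul_self_complex {x : ℝ} (hx : 0 ≤ x) :
    (Real.sqrt x : ℂ) * (Real.sqrt x : ℂ) = x := by
  rw [← Complex.ofReal_mul, Real.mul_self_sqrt hx]

theorem sub_single_add_single {k : Conf n} {j : Fin n} (h : k j ≠ 0) :
    k - Pi.single j 1 + Pi.single j 1 = k := by
  funext i
  by_cases hi : i = j
  · subst hi
    simp
    omega
  · simp [Pi.single_eq_of_ne hi]

theorem add_single_sub_comm {k : Conf n} {i j : Fin n} (h : i ≠ j) :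
    k + Pi.single i 1 - Pi.single j 1 = k - Pi.single j 1 + Pi.single i 1 := by
  funext l
  by_cases hi : l = i
  · subst hi
    simp [Pi.single_eq_of_ne h]
  · simp [Pi.single_eq_of_ne hi]

theorem cre_ann_apply (j : Fin n) (ψ : Coeffs n) (k : Conf n) :
    cre j (ann j ψ) k = (k j : ℂ) * ψ k := by
  rw [cre_apply, ann_apply]
  -- At k j = 0 the subtraction truncates, but the factor √(k j) vanishes.
  by_cases h : k j = 0
  · simp [h]
  · rw [sub_single_add_single h]
    have h1 : (((k - Pi.single j 1 : Conf n) j : ℕ) : ℝ) + 1 = (k j : ℝ) := by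
      have : (k - Pi.single j 1 : Conf n) j + 1 = k j := by simp; omega
      exact_mod_cast this
    rw [h1, ← mul_assoc, sqrt_mul_self_complex (Nat.cast_nonneg _)]
    simp

theorem ann_cre_self_apply (j : Fin n) (ψ : Coeffs n) (k : Conf n) :
    ann j (cre j ψ) k = ((k j : ℂ) + 1) * ψ k := by
  rw [ann_apply, cre_apply, add_tsub_cancel_right]
  have h1 : (((k + Pi.single j 1 : Conf n) j : ℕ) : ℝ) = (k j : ℝ) + 1 := by simp
  rw [h1, ← mul_assoc, sqrt_mul_self_complex (by positivity)]
  simp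

/-- `[aᵢ, aⱼ†] = δᵢⱼ`. -/
theorem ann_cre (i j : Fin n) (ψ : Coeffs n) :
    ann i (cre j ψ) = cre j (ann i ψ) + if i = j then ψ else 0 := by
  funext k
  by_cases h : i = j
  · subst h
    rw [Pi.add_apply, ann_cre_self_apply, cre_ann_apply]
    simp
    ring
  · simp only [h, if_false, add_zero]
    rw [ann_apply, cre_apply, cre_apply, ann_apply, add_single_sub_comm h]
    have h1 : (k + Pi.single i 1 : Conf n) j = k j := by simp [Pi.single_eq_of_ne' h]
    have h2 : (k - Pi.single j 1 : Conf n) i = k i := by simp [Pi.single_eq_of_ne h]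
    rw [h1, h2]
    ring

theorem ann_comm (i j : Fin n) (ψ : Coeffs n) : ann i (ann j ψ) = ann j (ann i ψ) := by
  funext k
  simp only [ann_apply]
  by_cases h : i = j
  · subst h; rfl
  · have h1 : (k + Pi.single i 1 : Conf n) j = k j := by simp [Pi.single_eq_of_ne' h]
    have h2 : (k + Pi.single j 1 : Conf n) i = k i := by simp [Pi.single_eq_of_ne h]
    rw [h1, h2, add_right_comm]
    ring

theorem annC_cre (c : Fin n → ℂ) (j : Fin n) (ψ : Coeffs n) :
    annC c (cre j ψ) = cre j (annC c ψ) + conj (c j) • ψ := by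
  simp only [annC, LinearMap.sum_apply, LinearMap.smul_apply, ann_cre, map_sum, map_smul,
    smul_add, Finset.sum_add_distrib, smul_ite, smul_zero, Finset.sum_ite_eq', Finset.mem_univ,
    if_true]

theorem annC_ann (c : Fin n → ℂ) (j : Fin n) (ψ : Coeffs n) :
    annC c (ann j ψ) = ann j (annC c ψ) := by
  simp only [annC, LinearMap.sum_apply, LinearMap.smul_apply, map_sum, map_smul]
  exact Finset.sum_congr rfl fun i _ => by rw [ann_comm]

theorem annC_creC (c : Fin n → ℂ) (ψ : Coeffs n) :
    annC c (creC c ψ) = creC c (annC c ψ) + (∑ j, c j * conj (c j)) • ψ := by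
  simp only [creC, LinearMap.sum_apply, LinearMap.smul_apply, map_sum, map_smul, annC_cre,
    smul_add, Finset.sum_add_distrib, smul_smul, Finset.sum_smul]

/-! ### The vector `m_c` -/

theorem mVec_zero (c : Fin n → ℂ) (j : Fin n) :
    mVec c (j, 0) = (1 / (Real.sqrt 2 : ℂ)) * c j := by
  rw [mVec, Matrix.mulVec, dotProduct, Fintype.sum_prod_type, Finset.sum_eq_single j]
  · simp [Umat, Matrix.kroneckerMap_apply, ← Complex.ofReal_inv]
  · intro i _ hi
    simp [Umat, Matrix.kroneckerMap_apply, Matrix.one_apply_ne hi]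
  · simp

theorem mVec_one (c : Fin n → ℂ) (j : Fin n) :
    mVec c (j, 1) = (-Complex.I / (Real.sqrt 2 : ℂ)) * c j := by
  rw [mVec, Matrix.mulVec, dotProduct, Fintype.sum_prod_type, Finset.sum_eq_single j]
  · simp [Umat, Matrix.kroneckerMap_apply, ← Complex.ofReal_inv, div_eq_mul_inv,
      mul_comm Complex.I]
  · intro i _ hi
    simp [Umat, Matrix.kroneckerMap_apply, Matrix.one_apply_ne hi]
  · simp

theorem quad_zero (j : Fin n) :
    quad (j, 0) = (1 / (Real.sqrt 2 : ℂ)) • (ann j + cre j) := by simp [quad]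

theorem quad_one (j : Fin n) :
    quad (j, 1) = (-Complex.I / (Real.sqrt 2 : ℂ)) • (ann j - cre j) := by simp [quad]

theorem inv_sqrt_two_sq : (1 / (Real.sqrt 2 : ℂ)) * (1 / (Real.sqrt 2 : ℂ)) = 1 / 2 := by
  rw [div_mul_div_comm, sqrt_mul_self_complex (by norm_num)]
  norm_num

theorem conj_inv_sqrt_two : conj (1 / (Real.sqrt 2 : ℂ)) = 1 / (Real.sqrt 2 : ℂ) := by
  rw [map_div₀, map_one, Complex.conj_ofReal]

theorem conj_mVec_zero (c : Fin n → ℂ) (j : Fin n) :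
    conj (mVec c (j, 0)) = (1 / (Real.sqrt 2 : ℂ)) * conj (c j) := by
  rw [mVec_zero, map_mul, conj_inv_sqrt_two]

theorem conj_mVec_one (c : Fin n → ℂ) (j : Fin n) :
    conj (mVec c (j, 1)) = (Complex.I / (Real.sqrt 2 : ℂ)) * conj (c j) := by
  rw [mVec_one, map_mul, map_div₀, map_neg, Complex.conj_I, Complex.conj_ofReal, neg_neg]

/-- `a(c) = m̄_c · r̂`. -/
theorem annC_eq_sum_quad (c : Fin n → ℂ) :
    annC c = ∑ i, conj (mVec c i) • quad i := by
  rw [Fintype.sum_prod_type, annC]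
  refine Finset.sum_congr rfl fun j _ => ?_
  rw [Fin.sum_univ_two, quad_zero, quad_one, conj_mVec_zero, conj_mVec_one]
  ext ψ k
  simp only [LinearMap.smul_apply, LinearMap.add_apply, LinearMap.sub_apply, Pi.smul_apply,
    Pi.add_apply, Pi.sub_apply, smul_eq_mul]
  have h := inv_sqrt_two_sq
  rw [div_eq_mul_inv, div_eq_mul_inv, div_eq_mul_inv] at *
  linear_combination (-(conj (c j)) * (ann j ψ k + cre j ψ k)
    + Complex.I * Complex.I * conj (c j) * (ann j ψ k - cre j ψ k)) * h
    + (1 / 2) * conj (c j) * (ann j ψ k - cre j ψ k) * Complex.I_mul_I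

/-- `a†(c) = m_c · r̂`. -/
theorem creC_eq_sum_quad (c : Fin n → ℂ) :
    creC c = ∑ i, mVec c i • quad i := by
  rw [Fintype.sum_prod_type, creC]
  refine Finset.sum_congr rfl fun j _ => ?_
  rw [Fin.sum_univ_two, quad_zero, quad_one, mVec_zero, mVec_one]
  ext ψ k
  simp only [LinearMap.smul_apply, LinearMap.add_apply, LinearMap.sub_apply, Pi.smul_apply,
    Pi.add_apply, Pi.sub_apply, smul_eq_mul]
  have h := inv_sqrt_two_sq
  rw [div_eq_mul_inv, div_eq_mul_inv] at *
  linear_combination (-(c j) * (ann j ψ k + cre j ψ k)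
    - Complex.I * Complex.I * c j * (ann j ψ k - cre j ψ k)) * h
    - (1 / 2) * c j * (ann j ψ k - cre j ψ k) * Complex.I_mul_I

/-- Each block of `Umat` is unitary, so m_c has the norm of c; this matches the moment value with
the commutator [a(c), a†(c)]. -/
theorem sum_mVec_mul_conj (c : Fin n → ℂ) :
    ∑ i, mVec c i * conj (mVec c i) = ∑ j, c j * conj (c j) := by
  rw [Fintype.sum_prod_type]
  refine Finset.sum_congr rfl fun j _ => ?_
  rw [Fin.sum_univ_two, conj_mVec_zero, conj_mVec_one, mVec_zero, mVec_one]
  have h := inv_sqrt_two_sq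
  rw [div_eq_mul_inv, div_eq_mul_inv] at *
  linear_combination (c j * conj (c j) - Complex.I * Complex.I * c j * conj (c j)) * h
    - (1 / 2) * c j * conj (c j) * Complex.I_mul_I

/-- `[a(c), r̂ᵢ] = (m̄_c)ᵢ`. -/
theorem annC_quad (c : Fin n → ℂ) (i : Fin n × Fin 2) (ψ : Coeffs n) :
    annC c (quad i ψ) = quad i (annC c ψ) + conj (mVec c i) • ψ := by
  obtain ⟨j, b⟩ := i
  fin_cases b
  · simp only [Fin.zero_eta, quad_zero, conj_mVec_zero, LinearMap.smul_apply, LinearMap.add_apply,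
      map_smul, map_add, annC_ann, annC_cre]
    module
  · simp only [Fin.mk_one, quad_one, conj_mVec_one, LinearMap.smul_apply, LinearMap.sub_apply,
      map_smul, map_sub, annC_ann, annC_cre]
    module

/-- `x̂ⱼ² + p̂ⱼ² = 2 a†ⱼ aⱼ + 1`. -/
theorem quad_sq_add_quad_sq (j : Fin n) (ψ : Coeffs n) (k : Conf n) :
    quad (j, 0) (quad (j, 0) ψ) k + quad (j, 1) (quad (j, 1) ψ) k
      = (2 * (k j : ℂ) + 1) * ψ k := by
  simp only [quad_zero, quad_one, LinearMap.smul_apply, LinearMap.add_apply, LinearMap.sub_apply,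
    map_smul, map_add, map_sub, Pi.smul_apply, Pi.add_apply, Pi.sub_apply, smul_eq_mul,
    cre_ann_apply, ann_cre_self_apply]
  have h := inv_sqrt_two_sq
  rw [div_eq_mul_inv, div_eq_mul_inv] at *
  set x := ann j (ann j ψ) k
  set y := cre j (cre j ψ) k
  set w := ((Real.sqrt 2 : ℝ) : ℂ)⁻¹
  -- The pure squares `x` and `y` enter x̂² and p̂² with opposite signs and cancel; only w² = 1/2
  -- and I² = -1 are needed.
  linear_combination (x + ((k j : ℂ) + 1) * ψ k + (k j : ℂ) * ψ k + y + Complex.I * Complex.I *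
    (x - ((k j : ℂ) + 1) * ψ k - (k j : ℂ) * ψ k + y)) * h + (1 / 2) *
    (x - ((k j : ℂ) + 1) * ψ k - (k j : ℂ) * ψ k + y) * Complex.I_mul_I

/-! ### Linearity of the mean -/

section Mean

variable {ρ : Fock n →L[ℂ] Fock n}

theorem HasMean.smul {T : Coeffs n →ₗ[ℂ] Coeffs n} {t : ℂ} (h : HasMean ρ T t) (a : ℂ) :
    HasMean ρ (a • T) (a * t) :=
  HasSum.mul_left a h

theorem HasMean.sum {ι : Type*} {s : Finset ι} {T : ι → Coeffs n →ₗ[ℂ] Coeffs n} {t : ι → ℂ}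
    (h : ∀ i ∈ s, HasMean ρ (T i) (t i)) : HasMean ρ (∑ i ∈ s, T i) (∑ i ∈ s, t i) := by
  have := hasSum_sum h
  simpa only [HasMean, LinearMap.sum_apply, Finset.sum_apply] using this

/-- The mean of the anticommutator of `∑ uᵢ r̂ᵢ` and `∑ wⱼ r̂ⱼ`. -/
theorem HasCovariance.hasMean {d : Fin n × Fin 2 → ℝ}
    {V : Matrix (Fin n × Fin 2) (Fin n × Fin 2) ℝ} (hV : HasCovariance ρ d V)
    (u w : Fin n × Fin 2 → ℂ) :
    HasMean ρ ((∑ i, u i • quad i) ∘ₗ (∑ j, w j • quad j) +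
        (∑ j, w j • quad j) ∘ₗ (∑ i, u i • quad i))
      (∑ i, u i * ∑ j, ((V i j : ℂ) * w j + 2 * d i * (w j * d j))) := by
  have h : ∀ i j, HasMean ρ (quad i ∘ₗ quad j + quad j ∘ₗ quad i)
      ((V i j : ℂ) + 2 * d i * d j) := by
    intro i j
    obtain ⟨s, hs, hVs⟩ := hV i j
    rwa [hVs, sub_add_cancel]
  have h2 := HasMean.sum (s := Finset.univ) fun i _ =>
    (HasMean.sum (s := Finset.univ) fun j _ => (h i j).smul (w j)).smul (u i)
  convert h2 using 1
  · ext ψ k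
    simp only [LinearMap.add_apply, LinearMap.comp_apply, LinearMap.sum_apply,
      LinearMap.smul_apply, map_sum, map_smul, Finset.smul_sum, smul_add, Finset.sum_add_distrib]
    refine congrFun (congrArg₂ (· + ·) ?_ rfl) k
    rw [Finset.sum_comm]
    exact Finset.sum_congr rfl fun i _ => Finset.sum_congr rfl fun j _ =>
      smul_comm (w j) (u i) (quad i (quad j ψ))
  · refine Finset.sum_congr rfl fun i _ => ?_
    congr 1
    exact Finset.sum_congr rfl fun j _ => by ring

theorem HasDisplacement.hasMean_annC {d : Fin n × Fin 2 → ℝ} (hd : HasDisplacement ρ d)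
    (c : Fin n → ℂ) : HasMean ρ (annC c) (∑ i, conj (mVec c i) * d i) := by
  rw [annC_eq_sum_quad]
  exact HasMean.sum fun i _ => (hd i).smul _

/-! ### Matrix elements through a square root of the state -/

/-- Operator positivity is the C*-algebra order, whose nonnegative elements are the S*S. The factor
need not be self-adjoint. -/
theorem exists_eq_star_mul_self {H : Type*} [NormedAddCommGroup H] [InnerProductSpace ℂ H]
    [CompleteSpace H] {T : H →L[ℂ] H} (hT : T.IsPositive) : ∃ S : H →L[ℂ] H, T = star S * S :=
  CStarAlgebra.nonneg_iff_eq_star_mul_self.mp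
    ((ContinuousLinearMap.nonneg_iff_isPositive T).mpr hT)

theorem coeff_eq_inner (ψ : Fock n) (k : Conf n) : coeff ψ k = inner ℂ (numState k) ψ := by
  rw [numState, lp.inner_single_left]
  rw [RCLike.inner_apply, map_one, mul_one]
  rfl

/-- Turns diagonal matrix elements of ρ into squared norms, so that vanishing means can force
vectors to vanish. -/
theorem IsState.exists_factor (hρ : IsState ρ) :
    ∃ S : Fock n →L[ℂ] Fock n, ∀ ψ k, coeff (ρ ψ) k = inner ℂ (S (numState k)) (S ψ) := by
  obtain ⟨S, hS⟩ := exists_eq_star_mul_self hρ.pos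
  refine ⟨S, fun ψ k => ?_⟩
  rw [coeff_eq_inner, hS, mul_apply_eq_comp, ContinuousLinearMap.star_eq_adjoint,
    ContinuousLinearMap.adjoint_inner_right]

/-- `a†(c) |k⟩`. -/
def creNum (c : Fin n → ℂ) (k : Conf n) : Fock n :=
  ∑ j, (c j * (Real.sqrt ((k j : ℝ) + 1) : ℂ)) • numState (k + Pi.single j 1)

theorem coeff_creNum (c : Fin n → ℂ) (k : Conf n) :
    coeff (creNum c k) = creC c (coeff (numState k)) := by
  simp only [creNum, creC, map_sum, map_smul, LinearMap.sum_apply, LinearMap.smul_apply,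
    cre_numState, smul_smul]

theorem numState_mem_creDomain (c : Fin n → ℂ) (k : Conf n) : numState k ∈ creDomain c := by
  change Memℓp (creC c (coeff (numState k))) 2
  rw [← coeff_creNum]
  exact (creNum c k).2

theorem creOp_numState (c : Fin n → ℂ) (k : Conf n) :
    creOp c ⟨numState k, numState_mem_creDomain c k⟩ = creNum c k :=
  Subtype.ext (coeff_creNum c k).symm

variable {S : Fock n →L[ℂ] Fock n}

/-- The annihilator moves to the left as a†(c) on a number state, a finite combination, so no domain
question arises. -/
theorem annC_coeff (hS : ∀ ψ k, coeff (ρ ψ) k = inner ℂ (S (numState k)) (S ψ))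
    (c : Fin n → ℂ) (ψ : Fock n) (k : Conf n) :
    annC c (coeff (ρ ψ)) k = inner ℂ (S (creNum c k)) (S ψ) := by
  rw [annC_apply, creNum, map_sum, sum_inner]
  refine Finset.sum_congr rfl fun j _ => ?_
  rw [hS, map_smul, inner_smul_left, map_mul, Complex.conj_ofReal, mul_assoc]

theorem subtracted_eq_zero_iff (hS : ∀ ψ k, coeff (ρ ψ) k = inner ℂ (S (numState k)) (S ψ))
    (c : Fin n → ℂ) : subtracted c ρ = 0 ↔ ∀ k, S (creNum c k) = 0 := by
  constructor
  · intro h k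
    -- The diagonal matrix element at k is ‖S a†(c)|k⟩‖².
    have h1 := congrFun (LinearMap.congr_fun h ⟨numState k, numState_mem_creDomain c k⟩) k
    have h2 : annC c (coeff (ρ (creOp c ⟨numState k, numState_mem_creDomain c k⟩))) k = 0 := h1
    rw [creOp_numState, annC_coeff hS] at h2
    exact inner_self_eq_zero.mp h2
  · intro h
    ext ψ k
    change annC c (coeff (ρ (creOp c ψ))) k = 0
    rw [annC_coeff hS, h, inner_zero_left]

/-- Finite second moments make the mean photon number of each mode finite. -/
theorem HasCovariance.summable_number
    (hS : ∀ ψ k, coeff (ρ ψ) k = inner ℂ (S (numState k)) (S ψ))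
    (hρ : IsState ρ) {d : Fin n × Fin 2 → ℝ}
    {V : Matrix (Fin n × Fin 2) (Fin n × Fin 2) ℝ} (hV : HasCovariance ρ d V) (j : Fin n) :
    Summable fun k : Conf n => (k j : ℝ) * ‖S (numState k)‖ ^ 2 := by
  obtain ⟨s, hs, -⟩ := hV (j, 0) (j, 0)
  obtain ⟨t, ht, -⟩ := hV (j, 1) (j, 1)
  -- The diagonal anticommutators are 2x̂² and 2p̂², with sum 4a†a + 2; hence the subtraction of 2
  -- Tr ρ and the factor 1/4.
  have h := ((hs.add ht).sub (hρ.trace_one.mul_left 2)).summable.mul_left (1 / 4)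
  have h2 := Complex.reCLM.summable h
  refine h2.congr fun k => ?_
  have e := quad_sq_add_quad_sq j (coeff (ρ (numState k))) k
  have e2 : coeff (ρ (numState k)) k = ((‖S (numState k)‖ ^ 2 : ℝ) : ℂ) := by
    rw [hS, inner_self_eq_norm_sq_to_K]
    simp
  have e3 : 1 / 4 * ((quad (j, 0) ∘ₗ quad (j, 0) + quad (j, 0) ∘ₗ quad (j, 0))
        (coeff (ρ (numState k))) k +
      (quad (j, 1) ∘ₗ quad (j, 1) + quad (j, 1) ∘ₗ quad (j, 1)) (coeff (ρ (numState k))) k -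
      2 * coeff (ρ (numState k)) k) = (((k j : ℝ) * ‖S (numState k)‖ ^ 2 : ℝ) : ℂ) := by
    simp only [LinearMap.add_apply, LinearMap.comp_apply, Pi.add_apply]
    rw [e2] at e ⊢
    push_cast at e ⊢
    linear_combination (1 / 2) * e
  simp only [e3]
  exact Complex.ofReal_re _

/-! ### Shifts of the number basis and the mean of a†(c)a(c) -/

theorem add_single_injective (j : Fin n) :
    Function.Injective fun k : Conf n => k + Pi.single j 1 :=
  fun _ _ h => by simpa using h

theorem notMem_range_add_single {j : Fin n} {k : Conf n}
    (h : k ∉ Set.range fun k : Conf n => k + Pi.single j 1) : k j = 0 := by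
  by_contra h0
  exact h ⟨_, sub_single_add_single h0⟩

theorem summable_norm_creNum
    (hS : ∀ j, Summable fun k : Conf n => (k j : ℝ) * ‖S (numState k)‖ ^ 2) (c : Fin n → ℂ) :
    Summable fun k : Conf n => ‖S (creNum c k)‖ ^ 2 := by
  have h : ∀ j, Summable fun k : Conf n =>
      ‖c j‖ ^ 2 * (((k j : ℝ) + 1) * ‖S (numState (k + Pi.single j 1))‖ ^ 2) := fun j => by
    have := ((hS j).comp_injective (add_single_injective j)).mul_left (‖c j‖ ^ 2)
    simpa [Function.comp_def] using this
  refine Summable.of_nonneg_of_le (fun _ => by positivity) (fun k => ?_)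
    ((summable_sum (s := Finset.univ) fun j _ => h j).mul_left (n : ℝ))
  have h1 : ‖S (creNum c k)‖ ≤
      ∑ j, ‖c j‖ * (Real.sqrt ((k j : ℝ) + 1) * ‖S (numState (k + Pi.single j 1))‖) := by
    rw [creNum, map_sum]
    refine norm_sum_le_of_le _ fun j _ => ?_
    rw [map_smul, norm_smul, norm_mul, Complex.norm_real, Real.norm_of_nonneg (Real.sqrt_nonneg _),
      mul_assoc]
  refine (pow_le_pow_left₀ (norm_nonneg _) h1 2).trans ?_
  -- Cauchy–Schwarz over the modes costs a factor n and leaves shifted photon-number series.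
  refine sq_sum_le_card_mul_sum_sq.trans ?_
  rw [Finset.card_univ, Fintype.card_fin]
  refine mul_le_mul_of_nonneg_left (le_of_eq ?_) (Nat.cast_nonneg _)
  refine Finset.sum_congr rfl fun j _ => ?_
  rw [mul_pow, mul_pow, Real.sq_sqrt (by positivity)]

/-- `Tr (a†(c) a(c) ρ) = ∑ₖ ‖√ρ a†(c) |k⟩‖²`. -/
theorem hasMean_creC_annC
    (hS : ∀ ψ k, coeff (ρ ψ) k = inner ℂ (S (numState k)) (S ψ))
    (hN : ∀ j, Summable fun k : Conf n => (k j : ℝ) * ‖S (numState k)‖ ^ 2) (c : Fin n → ℂ) :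
    HasMean ρ (creC c ∘ₗ annC c) ((∑' k, ‖S (creNum c k)‖ ^ 2 : ℝ) : ℂ) := by
  have hb := summable_norm_creNum hN c
  -- ‖S a†(c)|k⟩‖² is split by mode, since the reindexing k ↦ k + eⱼ depends on j; each piece must
  -- therefore be summable by itself.
  set f : Fin n → Conf n → ℂ := fun j k =>
    inner ℂ (S (creNum c k))
      ((c j * (Real.sqrt ((k j : ℝ) + 1) : ℂ)) • S (numState (k + Pi.single j 1))) with hf
  have hfs : ∀ j, Summable (f j) := by
    intro j
    have h1 : Summable fun k : Conf n =>
        ((k j : ℝ) + 1) * ‖S (numState (k + Pi.single j 1))‖ ^ 2 := by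
      have := (hN j).comp_injective (add_single_injective j)
      simpa [Function.comp_def] using this
    refine Summable.of_norm_bounded (hb.add (h1.mul_left (‖c j‖ ^ 2))) fun k => ?_
    refine (norm_inner_le_norm _ _).trans ?_
    rw [norm_smul, norm_mul, Complex.norm_real, Real.norm_of_nonneg (Real.sqrt_nonneg _)]
    have h2 : ‖c j‖ ^ 2 * (((k j : ℝ) + 1) * ‖S (numState (k + Pi.single j 1))‖ ^ 2) =
        (‖c j‖ * Real.sqrt ((k j : ℝ) + 1) * ‖S (numState (k + Pi.single j 1))‖) ^ 2 := by
      rw [mul_pow, mul_pow, Real.sq_sqrt (by positivity), mul_assoc]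
    -- What remains is xy ≤ x² + y².
    rw [h2]
    nlinarith [sq_nonneg (‖S (creNum c k)‖ -
      ‖c j‖ * Real.sqrt ((k j : ℝ) + 1) * ‖S (numState (k + Pi.single j 1))‖),
      sq_nonneg ‖S (creNum c k)‖,
      sq_nonneg (‖c j‖ * Real.sqrt ((k j : ℝ) + 1) * ‖S (numState (k + Pi.single j 1))‖)]
  have hg : ∀ j, HasSum (fun k : Conf n => c j * ((Real.sqrt (k j : ℝ) : ℂ) *
      annC c (coeff (ρ (numState k))) (k - Pi.single j 1))) (∑' k, f j k) := by
    intro j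
    -- Configurations outside the range of the shift have k j = 0, and there √(k j) kills the term.
    refine ((add_single_injective j).hasSum_iff fun k hk => ?_).mp ?_
    · simp [notMem_range_add_single hk]
    · convert (hfs j).hasSum using 1
      funext k
      simp only [hf, Function.comp_apply, add_tsub_cancel_right]
      rw [annC_coeff hS, inner_smul_right]
      simp [mul_assoc]
  have hsum := hasSum_sum (s := Finset.univ) fun j _ => hg j
  have heq : ∑ j, ∑' k, f j k = ((∑' k, ‖S (creNum c k)‖ ^ 2 : ℝ) : ℂ) := by
    rw [← Summable.tsum_finsetSum fun j _ => hfs j, Complex.ofReal_tsum]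
    refine tsum_congr fun k => ?_
    simp only [hf]
    rw [← inner_sum]
    have : ∑ j, (c j * (Real.sqrt ((k j : ℝ) + 1) : ℂ)) • S (numState (k + Pi.single j 1)) =
        S (creNum c k) := by
      rw [creNum, map_sum]
      exact Finset.sum_congr rfl fun j _ => (map_smul _ _ _).symm
    rw [this, inner_self_eq_norm_sq_to_K]
    simp
  rw [heq] at hsum
  simpa only [HasMean, LinearMap.comp_apply, creC_apply] using hsum

end Mean

/-! ### Photon subtraction and second moments -/

section Subtraction

variable {ρ : Fock n →L[ℂ] Fock n} {d : Fin n × Fin 2 → ℝ}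
  {V : Matrix (Fin n × Fin 2) (Fin n × Fin 2) ℝ} {c : Fin n → ℂ}

/-- With a(c)ρ = 0, the mean of {r̂ᵢ, a(c)} is the scalar commutator times Tr ρ; in the covariance
formula the displacement term drops because ⟨a(c)⟩ = 0. -/
theorem HasCovariance.mul_conj_mVec (hρ : IsState ρ) (hd : HasDisplacement ρ d)
    (hV : HasCovariance ρ d V) (h : ∀ k, annC c (coeff (ρ (numState k))) = 0) :
    (∀ i, ∑ j, (V i j : ℂ) * conj (mVec c j) = conj (mVec c i)) ∧
      ∑ i, conj (mVec c i) * d i = 0 := by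
  have hd0 : ∑ i, conj (mVec c i) * (d i : ℂ) = 0 := by
    refine (hd.hasMean_annC c).unique ?_
    simp only [h, Pi.zero_apply]
    exact hasSum_zero
  refine ⟨fun i => ?_, hd0⟩
  -- The unit vector selects r̂ᵢ; the other combination is a(c).
  have h1 := hV.hasMean (Pi.single i 1) fun j => conj (mVec c j)
  rw [← annC_eq_sum_quad] at h1
  have hq : ∑ l, (Pi.single i (1 : ℂ) : Fin n × Fin 2 → ℂ) l • quad l = quad i := by
    rw [Finset.sum_eq_single i (fun l _ hl => by rw [Pi.single_eq_of_ne hl, zero_smul])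
      (fun hi => absurd (Finset.mem_univ i) hi), Pi.single_eq_same, one_smul]
  rw [hq] at h1
  have h2 : HasMean ρ (quad i ∘ₗ annC c + annC c ∘ₗ quad i) (conj (mVec c i) * 1) := by
    refine (congrArg (HasSum · _) (funext fun k => ?_)).mpr
      (hρ.trace_one.mul_left (conj (mVec c i)))
    simp [annC_quad, h]
  have h3 := h1.unique h2
  rw [Finset.sum_eq_single i (fun l _ hl => by rw [Pi.single_eq_of_ne hl, zero_mul])
    (fun hi => absurd (Finset.mem_univ i) hi), Pi.single_eq_same, one_mul,
    Finset.sum_add_distrib, ← Finset.mul_sum, hd0, mul_zero, add_zero, mul_one] at h3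
  exact h3

/-- Two evaluations of ⟨{a†(c), a(c)}⟩, by moments and by normal ordering, differ by 2∑ₖ ‖S
a†(c)|k⟩‖², a series of nonnegative terms that must vanish. -/
theorem HasCovariance.creNum_eq_zero {S : Fock n →L[ℂ] Fock n}
    (hS : ∀ ψ k, coeff (ρ ψ) k = inner ℂ (S (numState k)) (S ψ))
    (hρ : IsState ρ) (hV : HasCovariance ρ d V)
    (hm : ∀ i, ∑ j, (V i j : ℂ) * conj (mVec c j) = conj (mVec c i))
    (hd : ∑ i, conj (mVec c i) * (d i : ℂ) = 0) (k : Conf n) : S (creNum c k) = 0 := by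
  have hN := hV.summable_number hS hρ
  have h1 := hV.hasMean (mVec c) fun j => conj (mVec c j)
  simp only [Finset.sum_add_distrib, ← Finset.mul_sum, hd, hm, mul_zero, add_zero] at h1
  rw [← annC_eq_sum_quad, ← creC_eq_sum_quad, sum_mVec_mul_conj] at h1
  have h2 : HasMean ρ (creC c ∘ₗ annC c + annC c ∘ₗ creC c)
      (2 * ((∑' k, ‖S (creNum c k)‖ ^ 2 : ℝ) : ℂ) + (∑ j, c j * conj (c j)) * 1) := by
    refine (congrArg (HasSum · _) (funext fun k => ?_)).mpr
      (((hasMean_creC_annC hS hN c).mul_left 2).add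
        (hρ.trace_one.mul_left (∑ j, c j * conj (c j))))
    simp only [LinearMap.add_apply, LinearMap.comp_apply, annC_creC, Pi.add_apply, Pi.smul_apply,
      smul_eq_mul]
    ring
  have h3 := h1.unique h2
  rw [mul_one, right_eq_add, mul_eq_zero, or_iff_right two_ne_zero, Complex.ofReal_eq_zero] at h3
  have h4 := (summable_norm_creNum hN c).hasSum
  rw [h3, hasSum_zero_iff_of_nonneg fun _ => by positivity] at h4
  simpa using congrFun h4 k

/-- V is real, so conjugation turns the eigenvector equation for m_c into the one for m̄_c, the
coefficient vector of a(c). -/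
theorem mVec_mem_ker_iff : mVec c ∈
      LinearMap.ker (V.map (fun x : ℝ => (x : ℂ)) - 1).mulVecLin ↔
    ∀ i, ∑ j, (V i j : ℂ) * conj (mVec c j) = conj (mVec c i) := by
  rw [LinearMap.mem_ker, Matrix.mulVecLin_apply, Matrix.sub_mulVec, Matrix.one_mulVec, sub_eq_zero,
    funext_iff]
  refine forall_congr' fun i => ?_
  rw [← (starRingEnd ℂ).injective.eq_iff, Matrix.mulVec, dotProduct, map_sum]
  simp

end Subtraction

end PhotonSub

end

open PhotonSub in
theorem lemma1 (n : ℕ) (ρ : Fock n →L[ℂ] Fock n) (d : Fin n × Fin 2 → ℝ)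
    (V : Matrix (Fin n × Fin 2) (Fin n × Fin 2) ℝ) (hρ : IsGaussianState ρ d V)
    (c : Fin n → ℂ) :
    subtracted c ρ = 0 ↔
      mVec c ∈ LinearMap.ker (V.map (fun x : ℝ => (x : ℂ)) - 1).mulVecLin ∧
        star (mVec c) ⬝ᵥ (fun i => (d i : ℂ)) = 0 := by
  obtain ⟨S, hS⟩ := hρ.isState.exists_factor
  rw [subtracted_eq_zero_iff hS, mVec_mem_ker_iff]
  constructor
  · intro h
    refine HasCovariance.mul_conj_mVec hρ.isState hρ.displacement hρ.covariance fun k => ?_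
    funext l
    rw [annC_coeff hS, h, inner_zero_left, Pi.zero_apply]
  · rintro ⟨hm, hd⟩ k
    exact hρ.covariance.creNum_eq_zero hS hρ.isState hm hd k
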